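/- Let $G=(V,E)$ be a finite, connected, simple, undirected, unweighted graph, let $u\neq v$ be two non-adjacent vertices of $G$, put $e=\{u,v\}$, and let $G'=(V,E\cup\{e\})$. For a connected graph $H$ on $V$ let $L_H$ be its Laplacian matrix, $\mathcal T_H$ the set of its spanning trees, and $R_H(u,v)=x_u-x_v$ the effective resistance, where $x\in\mathbb R^V$ is any solution of $L_Hx=\mathbf e_u-\mathbf e_v$ (the potential when a unit current enters at $u$ and leaves at $v$). For a tree $T$ on $V$ let $f^{(T)}$ be the unit electrical flow from $u$ to $v$ in $T$: for vertices $x,y$, $f^{(T)}(x,y)=1$ if the unique path of $T$ from $u$ to $v$ traverses the edge $\{x,y\}$ from $x$ to $y$, $f^{(T)}(x,y)=-1$ if it traverses it from $y$ to $x$, and $f^{(T)}(x,y)=0$ otherwise. Fix any path $u=v_0,v_1,\dots,v_k=v$ in $G'$ and set, for $T\in\mathcal T_{G'}$, $$F(T)=\sum_{i=0}^{k-1} f^{(T)}(v_i,v_{i+1}).$$ Let $\tau'$ be a uniformly distributed random spanning tree of $G'$. Then $$R_{G'}(u,v)=\frac{R_G(u,v)}{1+R_G(u,v)}\;\mathbb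 E\big[F(\tau')\mid e\in\tau'\big]+\frac{1}{1+R_G(u,v)}\;\mathbb E\big[F(\tau')\mid \tau'\in\mathcal T_G\big].$$ Moreover $R_G(u,v)>0$ (so this is a convex combination), $R_{G'}(u,v)=\frac{R_G(u,v)}{1+R_G(u,v)}$, the set of spanning trees of $G'$ that do not contain $e$ is exactly $\mathcal T_G$, and $$\mathbb P(e\in\tau')=\frac{R_G(u,v)}{1+R_G(u,v)}=R_{G'}(u,v),\qquad \mathbb P(\tau'\in\mathcal T_G)=\frac1{1+R_G(u,v)},$$ so that both conditioning events have positive probability. -/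

import Mathlib

open MeasureTheory ProbabilityTheory

noncomputable section

namespace USTUpdate

variable {V : Type*}

/-- `x` is a potential on the vertices of `G` when every edge is a unit resistor and a unit current
is injected at `a` and extracted at `b`: Kirchhoff's current law `L x = e_a - e_b`, where `L` is the
Laplacian matrix of `G`. -/
def IsUnitPotential [Fintype V] [DecidableEq V] (G : SimpleGraph V) (a b : V) (x : V → ℝ) : Prop :=
  letI : DecidableRel G.Adj := Classical.decRel _
  (G.lapMatrix ℝ).mulVec x = Pi.single a 1 - Pi.single b 1

open Classical in
/-- The effective resistance between `a` and `b` in `G`: the potential difference between `a` and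
`b` when a unit current is injected at `a` and extracted at `b`. (The value `0` is used if no such
current exists, which does not happen in a connected graph.) -/
def effRes [Fintype V] [DecidableEq V] (G : SimpleGraph V) (a b : V) : ℝ :=
  if h : ∃ x, IsUnitPotential G a b x then h.choose a - h.choose b else 0

/-- The effective resistance does not depend on the choice of the potential. -/
theorem IsUnitPotential.effRes_eq [Fintype V] [DecidableEq V] {G : SimpleGraph V} {a b : V}
    {x : V → ℝ} (hx : IsUnitPotential G a b x) : effRes G a b = x a - x b := by
  classical
  have h : ∃ x, IsUnitPotential G a b x := ⟨x, hx⟩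
  rw [effRes, dif_pos h]
  have hy := h.choose_spec
  generalize h.choose = y at hy
  unfold IsUnitPotential at hx hy
  let _ : DecidableRel G.Adj := Classical.decRel _
  have hs : (G.lapMatrix ℝ).transpose = G.lapMatrix ℝ := G.isSymm_lapMatrix ℝ
  have key : y ⬝ᵥ (G.lapMatrix ℝ).mulVec x = x ⬝ᵥ (G.lapMatrix ℝ).mulVec y := by
    rw [Matrix.dotProduct_mulVec, ← Matrix.mulVec_transpose, hs, dotProduct_comm]
  have e1 : y ⬝ᵥ (G.lapMatrix ℝ).mulVec x = y a - y b := by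
    rw [hx]; simp [dotProduct_sub]
  have e2 : x ⬝ᵥ (G.lapMatrix ℝ).mulVec y = x a - x b := by
    rw [hy]; simp [dotProduct_sub]
  linarith

/-- The set of all spanning trees of `G`; as a spanning tree has the same vertices as `G`, it is a
tree on the vertex type of `G` all of whose edges are edges of `G`. -/
def spanningTrees (G : SimpleGraph V) : Set (SimpleGraph V) :=
  {T | T ≤ G ∧ T.IsTree}

/-- The path from `u` to `v` in the tree `T` traverses the edge `{x, y}` in the direction from `x`
to `y`. -/
def TreePathTraverses (T : SimpleGraph V) (u v x y : V) : Prop :=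
  ∃ q : T.Walk u v, q.IsPath ∧ ∃ d ∈ q.darts, d.fst = x ∧ d.snd = y

open Classical in
/-- The value on the ordered pair `(x, y)` of the electrical flow in the tree `T` that carries a
unit current from `u` to `v`: it is `1` on the path of `T` from `u` to `v` in the direction of
travel, `-1` in the opposite direction, and `0` off that path. -/
def treeFlow (T : SimpleGraph V) (u v x y : V) : ℝ :=
  (if TreePathTraverses T u v x y then 1 else 0) - (if TreePathTraverses T u v y x then 1 else 0)

/-- The spanning-tree flow functional: for a walk `u = v₀, v₁, …, v_k = v` of `G`, the sum over `i`
of the values on `(v_i, v_{i+1})` of the unit flow from `u` to `v` in the tree `T`. -/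
def flowSum {G : SimpleGraph V} {u v : V} (p : G.Walk u v) (T : SimpleGraph V) : ℝ :=
  (p.darts.map fun d => treeFlow T u v d.fst d.snd).sum

/-- The conditional expectation of `X` given the event `A`. -/
def condExpect {Ω : Type*} [MeasurableSpace Ω] (P : Measure Ω) (X : Ω → ℝ) (A : Set Ω) : ℝ :=
  ∫ ω, X ω ∂(ProbabilityTheory.cond P A)

end USTUpdate

end

/-!
The proof counts forests. Let `N` be the number of spanning trees of a connected graph `H`, and let
`φ x` be the number of spanning forests of `H` with two components, one containing `u` and `x`, the
other containing `v`. Deleting the edge `{x, y}` matches the spanning trees whose path from `u` to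
`v` goes from `x` to `y` with the forests that have `x` on the side of `u` and `y` on the side of
`v` (`card_splitForests_eq_card_trees`). Hence `φ x - φ y` is the sum over all spanning trees `T` of
their flows from `x` to `y` (`forestPotential_sub`). Each tree flow has divergence `e_u - e_v`
(`sum_treeFlow`), so `φ / N` is a unit potential (`isUnitPotential_forestPotential`).

Three facts follow. Along any walk from `u` to `v` the drops of `φ` telescope, so the flow
functional averages to the effective resistance over all spanning trees (`sum_flowSum`). If `u` and
`v` are adjacent, the tree flow across `{u, v}` is the indicator of that edge, so the effective
resistance is the fraction of trees containing it (`card_filter_mem_edgeSet`). Finally, a unit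
potential of `G` is, up to scaling, one of the graph with the additional edge, which gives the
parallel law `R / (1 + R)` (`effRes_sup_edge`). The stated decomposition is then the law of total
expectation for the uniform spanning tree and the event that it contains the new edge.
-/

namespace USTUpdate

variable {V : Type*}

/-! ### Deleting an edge from a tree -/

/-- A trail runs through each of its edges once, so its two parts before and after a given edge
avoid that edge. -/
theorem reachable_deleteEdges_of_mem_darts {G : SimpleGraph V} {u v : V} {q : G.Walk u v}
    (hq : q.IsTrail) {d : G.Dart} (hd : d ∈ q.darts) :
    (G.deleteEdges {d.edge}).Reachable u d.fst ∧ (G.deleteEdges {d.edge}).Reachable d.snd v := by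
  induction q with
  | nil => simp at hd
  | @cons a b c h p ih =>
    rw [SimpleGraph.Walk.isTrail_cons] at hq
    rw [SimpleGraph.Walk.darts_cons, List.mem_cons] at hd
    rcases hd with rfl | hd
    · exact ⟨SimpleGraph.Reachable.refl _, ⟨p.toDeleteEdge s(a, b) hq.2⟩⟩
    · obtain ⟨h1, h2⟩ := ih hq.1 hd
      refine ⟨SimpleGraph.Reachable.trans (SimpleGraph.Adj.reachable ?_) h1, h2⟩
      rw [SimpleGraph.deleteEdges_adj]
      refine ⟨h, fun he => hq.2 ?_⟩
      rw [Set.mem_singleton_iff] at he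
      rw [he]
      exact List.mem_map_of_mem hd

theorem not_reachable_deleteEdges {T : SimpleGraph V} (hT : T.IsAcyclic) {x y : V}
    (h : T.Adj x y) : ¬ (T.deleteEdges {s(x, y)}).Reachable x y :=
  SimpleGraph.isBridge_iff.1 (SimpleGraph.isAcyclic_iff_forall_adj_isBridge.1 hT h)

theorem reachable_deleteEdges_or {T : SimpleGraph V} (hT : T.Preconnected) (x y w : V) :
    (T.deleteEdges {s(x, y)}).Reachable w x ∨ (T.deleteEdges {s(x, y)}).Reachable w y := by
  obtain ⟨p⟩ := hT w x
  generalize hz : x = z at p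
  induction p with
  | nil => subst hz; exact Or.inl (SimpleGraph.Reachable.refl _)
  | @cons a b c h p ih =>
    subst hz
    by_cases he : s(a, b) = s(x, y)
    · rcases Sym2.eq_iff.1 he with ⟨rfl, -⟩ | ⟨rfl, -⟩
      · exact Or.inl (SimpleGraph.Reachable.refl _)
      · exact Or.inr (SimpleGraph.Reachable.refl _)
    · have hab : (T.deleteEdges {s(x, y)}).Reachable a b :=
        SimpleGraph.Adj.reachable (by rw [SimpleGraph.deleteEdges_adj]; exact ⟨h, he⟩)
      exact (ih rfl).imp hab.trans hab.trans

/-- The path of a tree from `u` to `v` runs along the edge from `x` to `y` exactly when deleting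
that edge leaves `x` on the side of `u` and `y` on the side of `v`. -/
theorem treePathTraverses_iff {T : SimpleGraph V} (hT : T.IsTree) {u v x y : V} :
    TreePathTraverses T u v x y ↔ T.Adj x y ∧
      (T.deleteEdges {s(x, y)}).Reachable u x ∧ (T.deleteEdges {s(x, y)}).Reachable y v := by
  constructor
  · rintro ⟨q, hq, d, hd, rfl, rfl⟩
    exact ⟨d.adj, reachable_deleteEdges_of_mem_darts hq.isTrail hd⟩
  · rintro ⟨hxy, hux, hyv⟩
    have hbr := not_reachable_deleteEdges hT.isAcyclic hxy
    obtain ⟨q, hq, -⟩ := hT.existsUnique_path u v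
    have he : s(x, y) ∈ q.edges := by
      by_contra he
      exact hbr (hux.symm.trans (SimpleGraph.Reachable.trans ⟨q.toDeleteEdge _ he⟩ hyv.symm))
    obtain ⟨d, hd, hde⟩ := List.mem_map.1 he
    refine ⟨q, hq, d, hd, ?_⟩
    rcases SimpleGraph.dart_edge_eq_mk'_iff'.1 hde with h | h
    · exact h
    · -- In the opposite direction, `u` would be joined to both `x` and `y` off the deleted edge.
      have h1 := (reachable_deleteEdges_of_mem_darts hq.isTrail hd).1
      rw [hde, h.1] at h1
      exact absurd (hux.symm.trans h1) hbr

theorem TreePathTraverses.adj {T : SimpleGraph V} {u v x y : V}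
    (h : TreePathTraverses T u v x y) : T.Adj x y := by
  obtain ⟨q, -, d, -, rfl, rfl⟩ := h
  exact d.adj

theorem treeFlow_eq_zero_of_not_adj {T : SimpleGraph V} {u v x y : V} (h : ¬ T.Adj x y) :
    treeFlow T u v x y = 0 := by
  rw [treeFlow, if_neg fun h' => h h'.adj, if_neg fun h' => h h'.adj.symm, sub_zero]

open Classical in
/-- In a tree that contains the edge `{u, v}` the path from `u` to `v` is that edge alone. -/
theorem treeFlow_endpoints {T : SimpleGraph V} (hT : T.IsTree) (u v : V) :
    treeFlow T u v u v = if s(u, v) ∈ T.edgeSet then 1 else 0 := by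
  by_cases h : T.Adj u v
  · rw [if_pos (T.mem_edgeSet.2 h), treeFlow, if_pos ((treePathTraverses_iff hT).2 ⟨h, .refl _, .refl _⟩), if_neg, sub_zero]
    intro h'
    have := ((treePathTraverses_iff hT).1 h').2.1
    rw [Sym2.eq_swap] at this
    exact not_reachable_deleteEdges hT.isAcyclic h this
  · rw [if_neg fun h' => h (T.mem_edgeSet.1 h'), treeFlow_eq_zero_of_not_adj h]

/-! ### Kirchhoff's current law for the flow in a tree -/

open Classical in
/-- A path from `u` to `v` has net outflow `1` at `u`, `-1` at `v` and `0` elsewhere. On a path no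
dart is repeated, so that membership counts the traversals. -/
theorem sum_dart_indicator [Fintype V] [DecidableEq V] {G : SimpleGraph V} {u v : V} {q : G.Walk u v}
    (hq : q.IsPath) (x : V) :
    ∑ y, ((if ∃ d ∈ q.darts, d.fst = x ∧ d.snd = y then (1 : ℝ) else 0) -
      (if ∃ d ∈ q.darts, d.fst = y ∧ d.snd = x then 1 else 0)) =
      (if x = u then 1 else 0) - (if x = v then 1 else 0) := by
  induction q with
  | nil => simp
  | @cons a b c h p ih =>
    rw [SimpleGraph.Walk.cons_isPath_iff] at hq
    have hstep : ∀ s t : V,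
        (if ∃ d ∈ (SimpleGraph.Walk.cons h p).darts, d.fst = s ∧ d.snd = t then (1 : ℝ) else 0) =
          (if a = s ∧ b = t then 1 else 0) +
            (if ∃ d ∈ p.darts, d.fst = s ∧ d.snd = t then 1 else 0) := by
      intro s t
      by_cases hab : a = s ∧ b = t
      · have hno : ¬ ∃ d ∈ p.darts, d.fst = s ∧ d.snd = t := by
          rintro ⟨d, hd, h1, -⟩
          apply hq.2
          rw [hab.1, ← h1]
          exact p.dart_fst_mem_support_of_mem_darts hd
        simp [hab, hno]
      · simp [hab]
    have hs1 : ∑ y, (if a = x ∧ b = y then (1 : ℝ) else 0) = if x = a then 1 else 0 := by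
      by_cases hx : a = x
      · simp [hx]
      · simp [hx, Ne.symm hx]
    have hs2 : ∑ y, (if a = y ∧ b = x then (1 : ℝ) else 0) = if x = b then 1 else 0 := by
      by_cases hx : b = x
      · simp [hx]
      · simp [hx, Ne.symm hx]
    have ih' := ih hq.1
    rw [Finset.sum_sub_distrib] at ih'
    simp only [hstep, Finset.sum_sub_distrib, Finset.sum_add_distrib, hs1, hs2]
    linarith

theorem sum_treeFlow [Fintype V] [DecidableEq V] {T : SimpleGraph V} (hT : T.IsTree) (u v x : V) :
    ∑ y, treeFlow T u v x y = (if x = u then 1 else 0) - (if x = v then 1 else 0) := by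
  classical
  obtain ⟨q, hq, huniq⟩ := hT.existsUnique_path u v
  have htr : ∀ s t, TreePathTraverses T u v s t ↔ ∃ d ∈ q.darts, d.fst = s ∧ d.snd = t := by
    intro s t
    refine ⟨?_, fun h => ⟨q, hq, h⟩⟩
    rintro ⟨q', hq', h⟩
    rwa [huniq q' hq'] at h
  simp only [treeFlow, htr]
  convert sum_dart_indicator hq x

/-! ### Forests separating two vertices -/

/-- The spanning trees of a finite graph, as a finset. -/
noncomputable def treeFinset [Finite V] (G : SimpleGraph V) : Finset (SimpleGraph V) :=
  (Set.toFinite (spanningTrees G)).toFinset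

theorem mem_treeFinset [Finite V] {G T : SimpleGraph V} :
    T ∈ treeFinset G ↔ T ≤ G ∧ T.IsTree := by
  rw [treeFinset, Set.Finite.mem_toFinset]
  rfl

theorem treeFinset_nonempty [Finite V] {G : SimpleGraph V} (hG : G.Connected) :
    (treeFinset G).Nonempty := by
  obtain ⟨T, h1, h2⟩ := hG.exists_isTree_le
  exact ⟨T, mem_treeFinset.2 ⟨h1, h2⟩⟩

/-- The spanning forests of `G` with exactly two components, one containing `u` and the other
containing `v`. -/
noncomputable def splitForests [Finite V] (G : SimpleGraph V) (u v : V) : Finset (SimpleGraph V) :=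
  (Set.toFinite {F : SimpleGraph V | F ≤ G ∧ F.IsAcyclic ∧ ¬ F.Reachable u v ∧
    ∀ w, F.Reachable u w ∨ F.Reachable v w}).toFinset

theorem mem_splitForests [Finite V] {G F : SimpleGraph V} {u v : V} :
    F ∈ splitForests G u v ↔ F ≤ G ∧ F.IsAcyclic ∧ ¬ F.Reachable u v ∧
      ∀ w, F.Reachable u w ∨ F.Reachable v w := by
  rw [splitForests, Set.Finite.mem_toFinset]
  rfl

open Classical in
/-- The number of two-component spanning forests that separate `u` from `v` and have `x` on the
side of `u`. Divided by the number of spanning trees, it is the potential at `x`, grounded at `v`,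
of a unit current from `u` to `v`. -/
noncomputable def forestPotential [Finite V] (G : SimpleGraph V) (u v x : V) : ℝ :=
  ((splitForests G u v).filter fun F => F.Reachable u x).card

theorem sup_edge_deleteEdges {F : SimpleGraph V} {x y : V} (h : ¬ F.Adj x y) :
    (F ⊔ SimpleGraph.edge x y).deleteEdges {s(x, y)} = F := by
  simp [SimpleGraph.deleteEdges_sup, h]

theorem deleteEdges_sup_edge {T : SimpleGraph V} {x y : V} (h : T.Adj x y) :
    T.deleteEdges {s(x, y)} ⊔ SimpleGraph.edge x y = T := by
  ext a b
  simp only [SimpleGraph.sup_adj, SimpleGraph.deleteEdges_adj, SimpleGraph.edge_adj,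
    Set.mem_singleton_iff, Sym2.eq_iff]
  constructor
  · rintro (h' | ⟨⟨rfl, rfl⟩ | ⟨rfl, rfl⟩, -⟩)
    exacts [h'.1, h, h.symm]
  · intro h'
    have := h'.ne
    tauto

open Classical in
/-- Deleting the edge `{x, y}` turns the spanning trees whose path from `u` to `v` crosses from `x`
to `y` bijectively into the forests that have `x` on the side of `u` and `y` on the side of `v`. -/
theorem card_splitForests_eq_card_trees [Finite V] {G : SimpleGraph V} {u v x y : V}
    (hxy : G.Adj x y) :
    ((splitForests G u v).filter fun F => F.Reachable u x ∧ ¬ F.Reachable u y).card =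
      ((treeFinset G).filter fun T => TreePathTraverses T u v x y).card := by
  refine Finset.card_nbij' (fun F => F ⊔ SimpleGraph.edge x y)
    (fun T => T.deleteEdges {s(x, y)}) ?_ ?_ ?_ ?_
  · intro F hF
    simp only [Finset.coe_filter, mem_splitForests, mem_treeFinset, Set.mem_ofPred_eq] at hF ⊢
    obtain ⟨⟨hle, hac, huv, hcov⟩, hux, huy⟩ := hF
    have hvy : F.Reachable v y := (hcov y).resolve_left huy
    have hnxy : ¬ F.Reachable x y := fun h => huy (hux.trans h)
    have hadj : (F ⊔ SimpleGraph.edge x y).Adj x y := by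
      rw [SimpleGraph.sup_adj, SimpleGraph.edge_adj]
      exact Or.inr ⟨Or.inl ⟨rfl, rfl⟩, hxy.ne⟩
    have hmono : ∀ {a b}, F.Reachable a b → (F ⊔ SimpleGraph.edge x y).Reachable a b :=
      fun h => h.mono le_sup_left
    have huv' : (F ⊔ SimpleGraph.edge x y).Reachable u v :=
      (hmono hux).trans (hadj.reachable.trans (hmono hvy.symm))
    have hreach : ∀ w, (F ⊔ SimpleGraph.edge x y).Reachable u w := fun w =>
      (hcov w).elim hmono fun h => huv'.trans (hmono h)
    have htree : (F ⊔ SimpleGraph.edge x y).IsTree :=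
      ⟨(SimpleGraph.connected_iff_exists_forall_reachable _).2 ⟨u, hreach⟩,
        hac.sup_edge_of_not_reachable hnxy⟩
    refine ⟨⟨sup_le hle ((SimpleGraph.edge_le_iff ..).2 (Or.inr hxy)), htree⟩, ?_⟩
    rw [treePathTraverses_iff htree, sup_edge_deleteEdges fun h => hnxy h.reachable]
    exact ⟨hadj, hux, hvy.symm⟩
  · intro T hT
    simp only [Finset.coe_filter, mem_splitForests, mem_treeFinset, Set.mem_ofPred_eq] at hT ⊢
    obtain ⟨⟨hle, htree⟩, htr⟩ := hT
    obtain ⟨hadj, hux, hyv⟩ := (treePathTraverses_iff htree).1 htr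
    have hbr := not_reachable_deleteEdges htree.isAcyclic hadj
    refine ⟨⟨(SimpleGraph.deleteEdges_le _).trans hle,
      htree.isAcyclic.anti (SimpleGraph.deleteEdges_le _),
      fun h => hbr (hux.symm.trans (h.trans hyv.symm)), fun w => ?_⟩, hux,
      fun h => hbr (hux.symm.trans h)⟩
    exact (reachable_deleteEdges_or htree.connected.preconnected x y w).imp
      (fun h => hux.trans h.symm) (fun h => hyv.symm.trans h.symm)
  · intro F hF
    simp only [Finset.coe_filter, Set.mem_ofPred_eq] at hF
    exact sup_edge_deleteEdges fun h => hF.2.2 (hF.2.1.trans h.reachable)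
  · intro T hT
    simp only [Finset.coe_filter, Set.mem_ofPred_eq] at hT
    exact deleteEdges_sup_edge hT.2.adj

/-- Across an edge, the drop of the forest potential is the sum over all spanning trees of their
flows; forests with both ends of the edge on the same side cancel. -/
theorem forestPotential_sub [Finite V] {G : SimpleGraph V} (u v : V) {x y : V} (hxy : G.Adj x y) :
    forestPotential G u v x - forestPotential G u v y =
      ∑ T ∈ treeFinset G, treeFlow T u v x y := by
  classical
  have hx := Finset.card_filter_add_card_filter_not (s := (splitForests G u v).filter
    fun F => F.Reachable u x) (fun F => F.Reachable u y)
  have hy := Finset.card_filter_add_card_filter_not (s := (splitForests G u v).filter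
    fun F => F.Reachable u y) (fun F => F.Reachable u x)
  simp only [Finset.filter_filter] at hx hy
  rw [card_splitForests_eq_card_trees hxy] at hx
  rw [card_splitForests_eq_card_trees hxy.symm] at hy
  simp only [and_comm (a := SimpleGraph.Reachable _ u y)] at hy
  simp only [treeFlow, Finset.sum_sub_distrib, Finset.sum_boole, forestPotential]
  rw [← hx, ← hy]
  push_cast
  ring

/-! ### Effective resistance from spanning trees -/

theorem isUnitPotential_iff [Fintype V] [DecidableEq V] {G : SimpleGraph V} [DecidableRel G.Adj] {a b : V} {x : V → ℝ} :
    IsUnitPotential G a b x ↔ ∀ w, (∑ y, if G.Adj w y then x w - x y else 0) =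
      (if w = a then 1 else 0) - (if w = b then 1 else 0) := by
  have hL : IsUnitPotential G a b x ↔
      (G.lapMatrix ℝ).mulVec x = Pi.single a 1 - Pi.single b 1 := by
    rw [IsUnitPotential]; convert Iff.rfl
  rw [hL, funext_iff]
  refine forall_congr' fun w => ?_
  rw [SimpleGraph.lapMatrix_mulVec_apply, SimpleGraph.degree_eq_sum_if_adj, Finset.sum_mul,
    SimpleGraph.neighborFinset_eq_filter, Finset.sum_filter, ← Finset.sum_sub_distrib]
  simp only [Pi.sub_apply, Pi.single_apply]
  refine Eq.congr (Finset.sum_congr rfl fun y _ => ?_) rfl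
  split_ifs <;> simp

theorem isUnitPotential_forestPotential [Fintype V] [DecidableEq V] {G : SimpleGraph V}
    (hG : G.Connected) (u v : V) :
    IsUnitPotential G u v fun x => forestPotential G u v x / (treeFinset G).card := by
  classical
  have hN : ((treeFinset G).card : ℝ) ≠ 0 :=
    Nat.cast_ne_zero.2 (Finset.card_pos.2 (treeFinset_nonempty hG)).ne'
  rw [isUnitPotential_iff]
  intro w
  have h1 : ∀ y, (if G.Adj w y then forestPotential G u v w / (treeFinset G).card -
      forestPotential G u v y / (treeFinset G).card else 0) =
      (∑ T ∈ treeFinset G, treeFlow T u v w y) / (treeFinset G).card := by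
    intro y
    split_ifs with h
    · rw [← forestPotential_sub u v h, sub_div]
    · rw [Finset.sum_eq_zero, zero_div]
      exact fun T hT => treeFlow_eq_zero_of_not_adj fun h' => h ((mem_treeFinset.1 hT).1 h')
  rw [Finset.sum_congr rfl fun y _ => h1 y, ← Finset.sum_div, Finset.sum_comm,
    Finset.sum_congr rfl fun T hT => sum_treeFlow (mem_treeFinset.1 hT).2 u v w,
    Finset.sum_const, nsmul_eq_mul, mul_div_assoc, mul_div_cancel₀ _ hN]

theorem card_mul_effRes [Fintype V] [DecidableEq V] {G : SimpleGraph V}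
    (hG : G.Connected) (u v : V) :
    (treeFinset G).card * effRes G u v = forestPotential G u v u - forestPotential G u v v := by
  have hN : ((treeFinset G).card : ℝ) ≠ 0 :=
    Nat.cast_ne_zero.2 (Finset.card_pos.2 (treeFinset_nonempty hG)).ne'
  rw [(isUnitPotential_forestPotential hG u v).effRes_eq, ← sub_div, mul_div_cancel₀ _ hN]

/-- The average of the flow functional over all spanning trees is the effective resistance: along
the walk, the drops of the potential telescope. -/
theorem sum_flowSum [Fintype V] [DecidableEq V] {G : SimpleGraph V}
    (hG : G.Connected) {u v : V} (p : G.Walk u v) :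
    ∑ T ∈ treeFinset G, flowSum p T = (treeFinset G).card * effRes G u v := by
  rw [card_mul_effRes hG]
  -- The source and sink of the flow stay fixed while the ends of the walk vary.
  have key : ∀ {a b : V} (q : G.Walk a b),
      ∑ T ∈ treeFinset G, (q.darts.map fun d => treeFlow T u v d.fst d.snd).sum =
        forestPotential G u v a - forestPotential G u v b := by
    intro a b q
    induction q with
    | nil => simp
    | cons h q ih =>
      simp only [SimpleGraph.Walk.darts_cons, List.map_cons, List.sum_cons,
        Finset.sum_add_distrib]
      rw [ih, ← forestPotential_sub u v h]
      ring
  exact key p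

open Classical in
/-- The effective resistance across an edge is the fraction of spanning trees that contain it. -/
theorem card_filter_mem_edgeSet [Fintype V] [DecidableEq V] {G : SimpleGraph V}
    (hG : G.Connected) {u v : V} (huv : G.Adj u v) :
    (((treeFinset G).filter fun T => s(u, v) ∈ T.edgeSet).card : ℝ) =
      (treeFinset G).card * effRes G u v := by
  rw [card_mul_effRes hG, forestPotential_sub u v huv,
    Finset.sum_congr rfl fun T hT => treeFlow_endpoints (mem_treeFinset.1 hT).2 u v,
    Finset.sum_boole]

theorem effRes_pos [Fintype V] [DecidableEq V] {G : SimpleGraph V}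
    (hG : G.Connected) {u v : V} (huv : u ≠ v) : 0 < effRes G u v := by
  classical
  have hx := isUnitPotential_forestPotential hG u v
  generalize (fun x => forestPotential G u v x / ((treeFinset G).card : ℝ)) = x at hx
  rw [hx.effRes_eq]
  have hL : (G.lapMatrix ℝ).mulVec x = Pi.single u 1 - Pi.single v 1 := by
    rw [← hx]
  -- The effective resistance is the dissipated energy, the Laplacian quadratic form at `x`.
  have hE : Matrix.toLinearMap₂' ℝ (G.lapMatrix ℝ) x x = x u - x v := by
    rw [Matrix.toLinearMap₂'_apply', hL]
    simp [dotProduct_sub]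
  refine lt_of_le_of_ne ?_ fun h0 => ?_
  · rw [← hE, SimpleGraph.lapMatrix_toLinearMap₂']
    positivity
  · rw [← h0, SimpleGraph.lapMatrix_toLinearMap₂'_apply'_eq_zero_iff_forall_adj,
      ← SimpleGraph.lapMatrix_mulVec_eq_zero_iff_forall_adj, hL] at hE
    have := congrFun hE u
    simp [huv] at this

/-- Adding the edge `{u, v}` adds the current `x u - x v` to the divergence at `u` and subtracts it
at `v`, so that a unit potential stays one up to scaling. This is the parallel law for resistors. -/
theorem effRes_sup_edge [Fintype V] [DecidableEq V] {G : SimpleGraph V}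
    (hG : G.Connected) {u v : V} (huv : u ≠ v) (hadj : ¬ G.Adj u v) :
    effRes (G ⊔ SimpleGraph.edge u v) u v = effRes G u v / (1 + effRes G u v) := by
  classical
  have hpos := effRes_pos hG huv
  have hx := isUnitPotential_forestPotential hG u v
  generalize (fun x => forestPotential G u v x / ((treeFinset G).card : ℝ)) = x at hx
  have hR := hx.effRes_eq
  set R := effRes G u v
  have hR0 : 1 + R ≠ 0 := by positivity
  have hx' : IsUnitPotential (G ⊔ SimpleGraph.edge u v) u v fun w => x w / (1 + R) := by
    rw [isUnitPotential_iff] at hx ⊢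
    intro w
    have hterm : ∀ y, (if (G ⊔ SimpleGraph.edge u v).Adj w y
        then x w / (1 + R) - x y / (1 + R) else 0) =
        ((if G.Adj w y then x w - x y else 0) + (if y = v then if w = u then R else 0 else 0) -
          (if y = u then if w = v then R else 0 else 0)) / (1 + R) := by
      intro y
      simp only [SimpleGraph.sup_adj, SimpleGraph.edge_adj]
      by_cases h1 : w = u ∧ y = v
      · obtain ⟨rfl, rfl⟩ := h1
        simp [huv, hadj, hR, sub_div]
      by_cases h2 : w = v ∧ y = u
      · obtain ⟨rfl, rfl⟩ := h2
        have hadj' : ¬ G.Adj w y := fun h => hadj h.symm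
        simp [huv.symm, huv, hadj', hR, sub_div]
      have h3 : (if y = v then if w = u then R else 0 else 0) = 0 := by
        split_ifs <;> tauto
      have h4 : (if y = u then if w = v then R else 0 else 0) = 0 := by
        split_ifs <;> tauto
      rw [h3, h4]
      by_cases h : G.Adj w y
      · simp [h, sub_div]
      · rw [if_neg h, if_neg (by tauto)]
        simp
    rw [Finset.sum_congr rfl fun y _ => hterm y, ← Finset.sum_div, Finset.sum_sub_distrib,
      Finset.sum_add_distrib, hx w, Finset.sum_ite_eq', Finset.sum_ite_eq',
      if_pos (Finset.mem_univ _), if_pos (Finset.mem_univ _), div_eq_iff hR0]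
    split_ifs <;> ring
  rw [hx'.effRes_eq, hR, ← sub_div]

theorem spanningTrees_sup_edge {G : SimpleGraph V} {u v : V} (hadj : ¬ G.Adj u v) :
    {T | T ∈ spanningTrees (G ⊔ SimpleGraph.edge u v) ∧ s(u, v) ∉ T.edgeSet} =
      spanningTrees G := by
  ext T
  simp only [spanningTrees, Set.mem_ofPred_eq, SimpleGraph.mem_edgeSet]
  constructor
  · rintro ⟨⟨hle, hT⟩, hn⟩
    refine ⟨fun a b hab => ?_, hT⟩
    rcases hle hab with h | h
    · exact h
    · rw [SimpleGraph.edge_adj] at h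
      rcases h.1 with ⟨rfl, rfl⟩ | ⟨rfl, rfl⟩
      · exact absurd hab hn
      · exact absurd hab.symm hn
  · rintro ⟨hle, hT⟩
    exact ⟨⟨hle.trans le_sup_left, hT⟩, fun h => hadj (hle h)⟩

/-! ### Uniform spanning trees -/

instance [Countable V] : MeasurableSingletonClass (SimpleGraph V) where
  measurableSet_singleton G := by
    have : ({G} : Set (SimpleGraph V)) = ⋂ a, ⋂ b, {H | H.Adj a b ↔ G.Adj a b} := by
      ext H
      simp only [Set.mem_singleton_iff, Set.mem_iInter, Set.mem_ofPred_eq]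
      exact ⟨fun h a b => by rw [h], fun h => by ext a b; exact h a b⟩
    rw [this]
    refine MeasurableSet.iInter fun a => MeasurableSet.iInter fun b => ?_
    have h : MeasurableSet {H : SimpleGraph V | H.Adj a b} :=
      measurableSet_setOfPred.2 (SimpleGraph.measurable_iff_adj.1 measurable_id a b)
    by_cases hab : G.Adj a b
    · simpa only [hab, iff_true] using h
    · simp only [hab, iff_false]
      exact h.compl

section Uniform

variable {E : Type*} [MeasurableSpace E] [MeasurableSingletonClass E] [Finite E]
  {Ω : Type*} [MeasurableSpace Ω] {P : Measure Ω} {X : Ω → E} {S : Finset E}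

open Classical in
theorem setIntegral_comp_of_isUniform (hX : Measurable X)
    (hunif : pdf.IsUniform X (S : Set E) P Measure.count) (f : E → ℝ) (A : Set E) :
    ∫ ω in X ⁻¹' A, f (X ω) ∂P = (∑ T ∈ S with T ∈ A, f T) / S.card := by
  have hA : MeasurableSet A := A.toFinite.measurableSet
  have hS : Measure.count (S : Set E) = S.card := Measure.count_apply_finset S
  have hf : Measurable f := measurable_of_finite f
  rw [← setIntegral_map hA hf.aestronglyMeasurable hX.aemeasurable, hunif,
    ProbabilityTheory.cond, Measure.restrict_smul, integral_smul_measure,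
    Measure.restrict_restrict hA, hS]
  have hset : A ∩ (S : Set E) = ((S.filter fun T => T ∈ A : Finset E) : Set E) := by
    ext T; simp [and_comm]
  rw [hset, setIntegral_finset]
  · simp [Measure.real, div_eq_inv_mul]
  · exact (Integrable.of_finite (μ := Measure.count)).integrableOn

open Classical in
theorem measureReal_preimage_of_isUniform (hX : Measurable X)
    (hunif : pdf.IsUniform X (S : Set E) P Measure.count) (A : Set E) :
    P.real (X ⁻¹' A) = ((S.filter fun T => T ∈ A).card : ℝ) / S.card := by
  have h := setIntegral_comp_of_isUniform hX hunif (fun _ => 1) A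
  simpa using h

open Classical in
/-- The contribution of an event of positive probability to the law of total expectation, for a
uniformly distributed variable. -/
theorem measureReal_mul_condExpect (hX : Measurable X)
    (hunif : pdf.IsUniform X (S : Set E) P Measure.count) (f : E → ℝ) {A : Set E}
    (hA : P.real (X ⁻¹' A) ≠ 0) :
    P.real (X ⁻¹' A) * condExpect P (fun ω => f (X ω)) (X ⁻¹' A) =
      (∑ T ∈ S with T ∈ A, f T) / S.card := by
  rw [condExpect, ProbabilityTheory.cond, integral_smul_measure,
    setIntegral_comp_of_isUniform hX hunif, smul_eq_mul, ENNReal.toReal_inv, ← mul_assoc]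
  rw [← Measure.real, mul_inv_cancel₀ hA, one_mul]

end Uniform

end USTUpdate

open USTUpdate in
theorem mainTheorem1 {V : Type*} [Fintype V] [DecidableEq V] (G : SimpleGraph V)
    (hG : G.Connected) (u v : V) (huv : u ≠ v) (hadj : ¬ G.Adj u v)
    (G' : SimpleGraph V) (hG' : G' = G ⊔ SimpleGraph.edge u v)
    (p : G'.Walk u v) (hp : p.IsPath)
    {Ω : Type*} [MeasurableSpace Ω] (P : Measure Ω) [IsProbabilityMeasure P]
    (τ' : Ω → SimpleGraph V) (hτ' : Measurable τ')
    (hunif : pdf.IsUniform τ' (USTUpdate.spanningTrees G') P Measure.count) :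
    0 < USTUpdate.effRes G u v ∧
    USTUpdate.effRes G' u v = USTUpdate.effRes G u v / (1 + USTUpdate.effRes G u v) ∧
    {T | T ∈ USTUpdate.spanningTrees G' ∧ s(u, v) ∉ T.edgeSet} = USTUpdate.spanningTrees G ∧
    P.real {ω | s(u, v) ∈ (τ' ω).edgeSet} =
      USTUpdate.effRes G u v / (1 + USTUpdate.effRes G u v) ∧
    P.real {ω | τ' ω ∈ USTUpdate.spanningTrees G} = 1 / (1 + USTUpdate.effRes G u v) ∧
    USTUpdate.effRes G' u v =
      USTUpdate.effRes G u v / (1 + USTUpdate.effRes G u v) *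
          USTUpdate.condExpect P (fun ω => USTUpdate.flowSum p (τ' ω))
            {ω | s(u, v) ∈ (τ' ω).edgeSet} +
        1 / (1 + USTUpdate.effRes G u v) *
          USTUpdate.condExpect P (fun ω => USTUpdate.flowSum p (τ' ω))
            {ω | τ' ω ∈ USTUpdate.spanningTrees G} := by
  classical
  subst hG'
  have hG'c : (G ⊔ SimpleGraph.edge u v).Connected := hG.mono le_sup_left
  have hadj' : (G ⊔ SimpleGraph.edge u v).Adj u v := by
    rw [SimpleGraph.sup_adj, SimpleGraph.edge_adj]
    exact Or.inr ⟨Or.inl ⟨rfl, rfl⟩, huv⟩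
  have hpos := effRes_pos hG huv
  have hR' := effRes_sup_edge hG huv hadj
  have htrees := spanningTrees_sup_edge (G := G) hadj
  have hsum := sum_flowSum hG'c p
  have hcard := card_filter_mem_edgeSet hG'c hadj'
  set R := effRes G u v
  set S := treeFinset (G ⊔ SimpleGraph.edge u v)
  have hN : (S.card : ℝ) ≠ 0 :=
    Nat.cast_ne_zero.2 (Finset.card_pos.2 (treeFinset_nonempty hG'c)).ne'
  have hS : (S : Set (SimpleGraph V)) = spanningTrees (G ⊔ SimpleGraph.edge u v) :=
    Set.Finite.coe_toFinset _
  rw [← hS] at hunif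
  have hmem : ∀ T ∈ S, (T ∈ spanningTrees G ↔ s(u, v) ∉ T.edgeSet) := by
    intro T hT
    rw [← htrees, ← hS]
    exact and_iff_right hT
  have hfilt : S.filter (fun T => T ∈ spanningTrees G) = S.filter (fun T => s(u, v) ∉ T.edgeSet) :=
    Finset.filter_congr hmem
  have hP1 : P.real {ω | s(u, v) ∈ (τ' ω).edgeSet} = R / (1 + R) := by
    have h := measureReal_preimage_of_isUniform hτ' hunif {T | s(u, v) ∈ T.edgeSet}
    simp only [Set.mem_ofPred_eq] at h
    rw [hcard, hR', mul_div_cancel_left₀ _ hN] at h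
    exact h
  have hP2 : P.real {ω | τ' ω ∈ spanningTrees G} = 1 / (1 + R) := by
    have h := measureReal_preimage_of_isUniform hτ' hunif (spanningTrees G)
    have hc := Finset.card_filter_add_card_filter_not (s := S) fun T => s(u, v) ∈ T.edgeSet
    rw [← hfilt] at hc
    have hc' : ((S.filter fun T => T ∈ spanningTrees G).card : ℝ) = S.card * (1 / (1 + R)) := by
      have : (1 : ℝ) / (1 + R) = 1 - R / (1 + R) := by field_simp; ring
      rw [this, mul_sub, mul_one, ← hR', ← hcard, ← hc]
      push_cast
      ring
    rw [hc', mul_div_cancel_left₀ _ hN] at h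
    exact h
  refine ⟨hpos, hR', htrees, hP1, hP2, ?_⟩
  have h1 := measureReal_mul_condExpect hτ' hunif (flowSum p) (A := {T | s(u, v) ∈ T.edgeSet})
    (hP1.trans_ne (by positivity))
  have h2 := measureReal_mul_condExpect hτ' hunif (flowSum p) (A := spanningTrees G)
    (hP2.trans_ne (by positivity))
  simp only [hfilt, Set.mem_ofPred_eq, Set.preimage_ofPred_eq] at h1 h2
  rw [hP1] at h1
  rw [show τ' ⁻¹' spanningTrees G = {ω | τ' ω ∈ spanningTrees G} from rfl, hP2] at h2
  rw [h1, h2, ← add_div, Finset.sum_filter_add_sum_filter_not, hsum, mul_div_cancel_left₀ _ hN]
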